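/- Let $\mathcal H$ be a real or complex Hilbert space of finite dimension $n\ge 1$, and let $\mathbb S=\{x\in\mathcal H:\|x\|=1\}$. A finite family $\Phi=(\varphi_i)_{i=1}^N$ in $\mathcal H$ is a frame if it spans $\mathcal H$. A frame is equal-norm if there is $c>0$ with $\|\varphi_i\|=c$ for all $i$; it is tight if there is $A>0$ with $\sum_{i=1}^N|\langle x,\varphi_i\rangle|^2=A\|x\|^2$ for all $x\in\mathcal H$, and Parseval if this holds with $A=1$; it is orthogonal if $\langle\varphi_i,\varphi_j\rangle=0$ for all $i\ne j$. The normalized version of $\Phi$ is the family obtained by dividing each nonzero $\varphi_i$ by its norm (zero vectors are left unchanged). Let $P_{\langle y\rangle}$ be the orthogonal projection onto $\operatorname{span}\{y\}$ and put $$\mathcal R_\Phi(x)=\sum_{i=1}^N\|P_{\langle\varphi_i\rangle}x\|^2,\qquad \mathcal R^+_\Phi=\max_{x\in\mathbb S}\mathcal R_\Phi(x),\qquad \mathcal R^-_\Phi=\min_{x\in\mathbb S}\mathcal R_\Phi(x).$$ The union $\Phi\cup\Psi$ of two families is their concatenation (with repetitions), and sets of frame vectors are understood as sets of indices in $\{1,\dots,N\}$.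 **Theorem.** Let $\Phi=(\varphi_i)_{i=1}^N$ be a frame for $\mathcal H$. - [D1] If $\Phi$ is an equal-norm Parseval frame, then $\mathcal R^-_\Phi=\mathcal R^+_\Phi=\frac Nn$. - [D2] $\mathcal R^-_\Phi=\mathcal R^+_\Phi$ if and only if the normalized version of $\Phi$ is tight. Also, $\mathcal R^-_\Phi=\mathcal R^+_\Phi=1$ if and only if $\Phi$ is orthogonal. - [D3] The maximum and the minimum above are attained, and $0<\mathcal R^-_\Phi\le\mathcal R^+_\Phi<\infty$. - [D4] For each orthonormal basis $(e_i)_{i=1}^n$ of $\mathcal H$, $\mathcal R^\pm_{\Phi\cup(e_i)_{i=1}^n}=\mathcal R^\pm_\Phi+1$. For each (finite) frame $\Phi'$ for $\mathcal H$, $\mathcal R^-_{\Phi\cup\Phi'}\ge\mathcal R^-_\Phi+\mathcal R^-_{\Phi'}$ and $\mathcal R^+_{\Phi\cup\Phi'}\le\mathcal R^+_\Phi+\mathcal R^+_{\Phi'}$. In particular, if $\mathcal R^-_\Phi=\mathcal R^+_\Phi=r$ and $\mathcal R^-_{\Phi'}=\mathcal R^+_{\Phi'}=r'$, then $\mathcal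 R^-_{\Phi\cup\Phi'}=r+r'=\mathcal R^+_{\Phi\cup\Phi'}$. - [D5] $\mathcal R^\pm_{(U\varphi_i)_{i=1}^N}=\mathcal R^\pm_\Phi$ for every unitary operator $U$ on $\mathcal H$; $\mathcal R^\pm_{(c_i\varphi_i)_{i=1}^N}=\mathcal R^\pm_\Phi$ for all nonzero scalars $c_1,\dots,c_N$; and $\mathcal R^\pm_{(\varphi_{\pi(i)})_{i=1}^N}=\mathcal R^\pm_\Phi$ for every permutation $\pi$ of $\{1,\dots,N\}$. - [D6] $\Phi$ contains $\lfloor\mathcal R^-_\Phi\rfloor$ pairwise disjoint spanning sets. In particular, whenever at most $\lfloor\mathcal R^-_\Phi\rfloor-1$ vectors are deleted from $\Phi$, the remaining vectors still form a frame for $\mathcal H$. - [D7] If $\Phi$ contains no zero vectors, then it can be partitioned into $\lceil\mathcal R^+_\Phi\rceil$ nonempty linearly independent sets. -/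

import Mathlib

namespace FiniteFrame

/-- A finite family of vectors is a frame for a finite-dimensional space if it spans it. -/
def IsFrame (𝕜 : Type*) [RCLike 𝕜] {H : Type*} [NormedAddCommGroup H] [InnerProductSpace 𝕜 H]
    {N : ℕ} (φ : Fin N → H) : Prop :=
  Submodule.span 𝕜 (Set.range φ) = ⊤

/-- `φ` is an `A`-tight frame: both frame bounds can be chosen equal to `A > 0`. -/
def IsTightWith (𝕜 : Type*) [RCLike 𝕜] {H : Type*} [NormedAddCommGroup H]
    [InnerProductSpace 𝕜 H] {N : ℕ} (φ : Fin N → H) (A : ℝ) : Prop :=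
  0 < A ∧ ∀ x : H, ∑ i, ‖inner 𝕜 x (φ i)‖ ^ 2 = A * ‖x‖ ^ 2

/-- `φ` is a tight frame. -/
def IsTight (𝕜 : Type*) [RCLike 𝕜] {H : Type*} [NormedAddCommGroup H] [InnerProductSpace 𝕜 H]
    {N : ℕ} (φ : Fin N → H) : Prop :=
  ∃ A : ℝ, IsTightWith 𝕜 φ A

/-- `φ` is a Parseval frame. -/
def IsParseval (𝕜 : Type*) [RCLike 𝕜] {H : Type*} [NormedAddCommGroup H]
    [InnerProductSpace 𝕜 H] {N : ℕ} (φ : Fin N → H) : Prop :=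
  IsTightWith 𝕜 φ 1

/-- `φ` is equal-norm: all its vectors have the same positive norm. -/
def IsEqualNorm {H : Type*} [NormedAddCommGroup H] {N : ℕ} (φ : Fin N → H) : Prop :=
  ∃ c : ℝ, 0 < c ∧ ∀ i, ‖φ i‖ = c

/-- The vectors of `φ` are mutually orthogonal. -/
def IsOrthogonal (𝕜 : Type*) [RCLike 𝕜] {H : Type*} [NormedAddCommGroup H]
    [InnerProductSpace 𝕜 H] {N : ℕ} (φ : Fin N → H) : Prop :=
  ∀ i j, i ≠ j → inner 𝕜 (φ i) (φ j) = 0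

/-- The normalized version of `φ`: every nonzero vector is divided by its norm, and zero
vectors stay zero (so that its frame operator is the sum of the projections onto the lines
spanned by the vectors of `φ`). -/
noncomputable def normalized (𝕜 : Type*) [RCLike 𝕜] {H : Type*} [NormedAddCommGroup H]
    [InnerProductSpace 𝕜 H] {N : ℕ} (φ : Fin N → H) : Fin N → H :=
  fun i => ((‖φ i‖⁻¹ : ℝ) : 𝕜) • φ i

/-- The redundancy function: the sum of the squared norms of the orthogonal projections of `x`
onto the spans of the single frame vectors. -/
noncomputable def redundancy (𝕜 : Type*) [RCLike 𝕜] {H : Type*} [NormedAddCommGroup H]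
    [InnerProductSpace 𝕜 H] {N : ℕ} (φ : Fin N → H) (x : H) : ℝ :=
  ∑ i, ‖(Submodule.span 𝕜 {φ i}).starProjection x‖ ^ 2

/-- The set of values of the redundancy function on the unit sphere. -/
def redundancyValues (𝕜 : Type*) [RCLike 𝕜] {H : Type*} [NormedAddCommGroup H]
    [InnerProductSpace 𝕜 H] {N : ℕ} (φ : Fin N → H) : Set ℝ :=
  redundancy 𝕜 φ '' Metric.sphere (0 : H) 1

/-- The upper redundancy, the largest value of the redundancy function on the unit sphere. -/
noncomputable def upperRedundancy (𝕜 : Type*) [RCLike 𝕜] {H : Type*} [NormedAddCommGroup H]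
    [InnerProductSpace 𝕜 H] {N : ℕ} (φ : Fin N → H) : ℝ :=
  sSup (redundancyValues 𝕜 φ)

/-- The lower redundancy, the smallest value of the redundancy function on the unit sphere. -/
noncomputable def lowerRedundancy (𝕜 : Type*) [RCLike 𝕜] {H : Type*} [NormedAddCommGroup H]
    [InnerProductSpace 𝕜 H] {N : ℕ} (φ : Fin N → H) : ℝ :=
  sInf (redundancyValues 𝕜 φ)

end FiniteFrame

/-! The redundancy function is the quadratic form `∑ ‖⟪x, ψ i⟫‖²` of the frame operator of the
normalized vectors `ψ i`, and the two redundancies are its extreme values on the unit sphere. With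
compactness, homogeneity and traces this gives [D1]–[D5].

For [D6] and [D7], sum the form over an orthonormal basis of a subspace `W`: the result is `∑ ‖P_W
(ψ i)‖²`. Each nonzero frame vector in `W` contributes 1, so a frame without zero vectors has at
most `R⁺ · dim W` members in `W` (`card_mem_le`). Over `Wᗮ`, members of `W` contribute 0 and all
others at most 1, so at least `R⁻ · dim Wᗮ` members lie outside `W` (`le_card_of_forall_notMem`).
These are Edmonds' conditions for covering by `⌈R⁺⌉` independent sets and for packing `⌊R⁻⌋`
spanning sets. Both of Edmonds' theorems follow from the equality case of matroid union,
`exists_indepColouring_card_eq`, proved by an exchange argument on partial colourings. -/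

/-- The indices in the `j`-th block of a partial colouring. -/
abbrev colourBlock {ι : Type*} {k : ℕ} (f : ι → Option (Fin k)) (j : Fin k) : Set ι :=
  {i | f i = some j}

/-- Colour the uncoloured index `x` with the colour `j` of `y`, and remove the colour of `y`. -/
def colourSwap {ι : Type*} [DecidableEq ι] {k : ℕ} (f : ι → Option (Fin k)) (x y : ι)
    (j : Fin k) : ι → Option (Fin k) :=
  Function.update (Function.update f y none) x (some j)

/-- All blocks of the partial colouring are linearly independent. -/
def IndepColouring (K : Type*) [Field K] {V : Type*} [AddCommGroup V] [Module K V] {ι : Type*}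
    {k : ℕ} (v : ι → V) (f : ι → Option (Fin k)) : Prop :=
  ∀ j, LinearIndepOn K v (colourBlock f j)

/-- One exchange between a block and the uncoloured indices that keeps the blocks independent. -/
def ColourExchange (K : Type*) [Field K] {V : Type*} [AddCommGroup V] [Module K V] {ι : Type*}
    [DecidableEq ι] {k : ℕ} (v : ι → V) (f g : ι → Option (Fin k)) : Prop :=
  ∃ x y j, f x = none ∧ f y = some j ∧ v x ∉ Submodule.span K (v '' (colourBlock f j \ {y})) ∧
    g = colourSwap f x y j

/-! ### Matroid union for vectors, by exchanges between colour blocks -/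

section Colouring

variable {K : Type*} [Field K] {V : Type*} [AddCommGroup V] [Module K V] {ι : Type*}
  {k : ℕ} {v : ι → V}

/-- A vector in the span of an independent family is in the span of the members of the family
that cannot be omitted. -/
theorem LinearIndepOn.mem_span_essential {s : Set ι} (hs : LinearIndepOn K v s) {w : V}
    (hw : w ∈ Submodule.span K (v '' s)) :
    w ∈ Submodule.span K (v '' {y ∈ s | w ∉ Submodule.span K (v '' (s \ {y}))}) := by
  classical
  rw [Finsupp.mem_span_image_iff_linearCombination] at hw
  obtain ⟨l, hl, rfl⟩ := hw
  rw [Finsupp.mem_span_image_iff_linearCombination]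
  refine ⟨l, ?_, rfl⟩
  rw [Finsupp.mem_supported] at hl ⊢
  intro y hy
  refine ⟨hl hy, fun hmem => ?_⟩
  refine (linearIndepOn_iff_notMem_span.1 hs) y (hl hy) ?_
  -- If `w` were in the span without `y`, then since `y` has a nonzero coefficient in `w`, one could
  -- solve for `v y` in terms of the other members, against independence.
  have hly : l y ≠ 0 := Finsupp.mem_support_iff.1 hy
  have herase : Finsupp.linearCombination K v (l.erase y) ∈
      Submodule.span K (v '' (s \ {y})) := by
    rw [Finsupp.mem_span_image_iff_linearCombination]
    refine ⟨l.erase y, ?_, rfl⟩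
    rw [Finsupp.mem_supported, Finsupp.support_erase]
    intro z hz
    rw [Finset.mem_coe, Finset.mem_erase] at hz
    exact ⟨hl hz.2, hz.1⟩
  have hsum : Finsupp.linearCombination K v l =
      l y • v y + Finsupp.linearCombination K v (l.erase y) := by
    conv_lhs => rw [← Finsupp.single_add_erase y l]
    rw [map_add, Finsupp.linearCombination_single]
  rw [hsum] at hmem
  have := (Submodule.add_mem_iff_left _ herase).1 hmem
  exact (Submodule.smul_mem_iff _ hly).1 this

theorem LinearIndepOn.card_eq_finrank_span {s : Finset ι} (hs : LinearIndepOn K v (s : Set ι)) :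
    Module.finrank K (Submodule.span K (v '' (s : Set ι))) = s.card := by
  have := finrank_span_eq_card hs.linearIndependent
  rw [Set.image_eq_range]
  simpa using this

variable [DecidableEq ι]

theorem colourBlock_colourSwap_self {f : ι → Option (Fin k)} {x y : ι} {j : Fin k} :
    colourBlock (colourSwap f x y j) j = insert x (colourBlock f j \ {y}) := by
  ext i
  by_cases h1 : i = x
  · simp [colourSwap, h1]
  · by_cases h2 : i = y <;> simp [colourSwap, h1, h2, Function.update_apply]

theorem colourBlock_colourSwap_of_ne {f : ι → Option (Fin k)} {x y : ι} {j l : Fin k}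
    (hx : f x = none) (hy : f y = some j) (hl : l ≠ j) :
    colourBlock (colourSwap f x y j) l = colourBlock f l := by
  ext i
  by_cases h1 : i = x
  · subst h1; simp [colourSwap, hx, hl.symm]
  · by_cases h2 : i = y
    · subst h2; simp [colourSwap, h1, hy, hl.symm]
    · simp [colourSwap, h1, h2]

theorem IndepColouring.exchange {f g : ι → Option (Fin k)} (hf : IndepColouring K v f)
    (h : ColourExchange K v f g) : IndepColouring K v g := by
  obtain ⟨x, y, j, hx, hy, hs, rfl⟩ := h
  intro l
  by_cases hl : l = j
  · subst hl
    rw [colourBlock_colourSwap_self]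
    exact ((hf l).mono Set.sdiff_subset).insert hs
  · rw [colourBlock_colourSwap_of_ne hx hy hl]
    exact hf l

variable [Fintype ι]

theorem card_coloured_colourSwap {f : ι → Option (Fin k)} {x y : ι} {j : Fin k}
    (hx : f x = none) (hy : f y = some j) :
    (Finset.univ.filter fun i => colourSwap f x y j i ≠ none).card =
      (Finset.univ.filter fun i => f i ≠ none).card := by
  have hxy : x ≠ y := by rintro rfl; simp [hx] at hy
  have h : (Finset.univ.filter fun i => colourSwap f x y j i ≠ none) =
      insert x ((Finset.univ.filter fun i => f i ≠ none).erase y) := by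
    ext i
    rw [Finset.mem_filter, Finset.mem_insert, Finset.mem_erase, Finset.mem_filter]
    by_cases h1 : i = x
    · simp [colourSwap, h1]
    · by_cases h2 : i = y
      · subst h2; simp [colourSwap, h1]
      · simp [colourSwap, h1, h2]
  rw [h, Finset.card_insert_of_notMem (by simp [hx]),
    Finset.card_erase_add_one (by simp [hy])]

theorem ColourExchange.card_eq {f g : ι → Option (Fin k)} (h : ColourExchange K v f g) :
    (Finset.univ.filter fun i => g i ≠ none).card =
      (Finset.univ.filter fun i => f i ≠ none).card := by
  obtain ⟨x, y, j, hx, hy, -, rfl⟩ := h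
  exact card_coloured_colourSwap hx hy

/-- Otherwise `x` could receive the colour `j`, giving a larger independent colouring. -/
theorem IndepColouring.mem_span_of_uncoloured {f : ι → Option (Fin k)}
    (hf : IndepColouring K v f)
    (hmax : ∀ g : ι → Option (Fin k), IndepColouring K v g →
      (Finset.univ.filter fun i => g i ≠ none).card ≤
        (Finset.univ.filter fun i => f i ≠ none).card)
    {x : ι} (hx : f x = none) (j : Fin k) :
    v x ∈ Submodule.span K (v '' colourBlock f j) := by
  by_contra hs
  have hb : ∀ l, colourBlock (Function.update f x (some j)) l =
      if l = j then insert x (colourBlock f j) else colourBlock f l := by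
    intro l
    ext i
    by_cases hl : l = j
    · subst hl
      by_cases h1 : i = x <;> simp [h1]
    · by_cases h1 : i = x
      · subst h1; simp [hl, hx, Ne.symm hl]
      · simp [h1, hl]
  have hg : IndepColouring K v (Function.update f x (some j)) := by
    intro l
    rw [hb]
    split_ifs
    · exact (hf j).insert hs
    · exact hf l
  have hc : (Finset.univ.filter fun i => Function.update f x (some j) i ≠ none) =
      insert x (Finset.univ.filter fun i => f i ≠ none) := by
    ext i
    by_cases h1 : i = x <;> simp [Function.update_apply, h1]
  have := hmax _ hg
  rw [hc, Finset.card_insert_of_notMem (by simp [hx])] at this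
  omega

/-- The rank formula for the union of `k` copies of a linear matroid: some `k` disjoint
independent sets and some set `A` attain equality. -/
theorem exists_indepColouring_card_eq (K : Type*) [Field K] {V : Type*} [AddCommGroup V]
    [Module K V] {ι : Type*} [Fintype ι] [DecidableEq ι] (v : ι → V) (k : ℕ) :
    ∃ (f : ι → Option (Fin k)) (A : Finset ι), IndepColouring K v f ∧
      (Finset.univ.filter fun i => f i ≠ none).card =
        k * Module.finrank K (Submodule.span K (v '' (A : Set ι))) + Aᶜ.card := by
  classical
  obtain ⟨f, hf, hmax⟩ := Set.exists_max_image {f : ι → Option (Fin k) | IndepColouring K v f}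
    (fun f => (Finset.univ.filter fun i => f i ≠ none).card) (Set.toFinite _)
    ⟨fun _ => none, fun j => by simp [colourBlock]⟩
  -- Exchanges preserve independence and size, so every reachable colouring is again maximal.
  have hreach : ∀ g, Relation.ReflTransGen (ColourExchange K v) f g → IndepColouring K v g ∧
      (Finset.univ.filter fun i => g i ≠ none).card =
        (Finset.univ.filter fun i => f i ≠ none).card := by
    intro g hg
    induction hg with
    | refl => exact ⟨hf, rfl⟩
    | tail _ hstep ih => exact ⟨ih.1.exchange hstep, hstep.card_eq.trans ih.2⟩
  -- The extremal set: all indices left uncoloured by some reachable colouring.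
  let A : Finset ι := Finset.univ.filter fun x =>
    ∃ g, Relation.ReflTransGen (ColourExchange K v) f g ∧ g x = none
  have hAmem : ∀ {x}, x ∈ A ↔ ∃ g, Relation.ReflTransGen (ColourExchange K v) f g ∧
      g x = none := by intro x; simp [A]
  -- By maximality `v x` lies in the span of block `j`, hence of the members essential to it.
  -- Exchanging such a member with `x` uncolours it, so it belongs to `A`.
  have hspan : ∀ g, Relation.ReflTransGen (ColourExchange K v) f g → ∀ x, g x = none → ∀ j,
      v x ∈ Submodule.span K (v '' (colourBlock g j ∩ A)) := by
    intro g hg x hx j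
    obtain ⟨hgi, hgc⟩ := hreach g hg
    have h1 := hgi.mem_span_of_uncoloured (fun g' hg' => hgc ▸ hmax g' hg') hx j
    refine Submodule.span_mono (Set.image_mono ?_) ((hgi j).mem_span_essential h1)
    rintro y ⟨hy, hys⟩
    refine ⟨hy, hAmem.2 ⟨_, hg.tail ⟨x, y, j, hx, hy, hys, rfl⟩, ?_⟩⟩
    have hxy : y ≠ x := by rintro rfl; simp [colourBlock, hx] at hy
    simp [colourSwap, hxy]
  -- An exchange cannot enlarge the span of a block within `A`: by `hspan`, the incoming vector is
  -- already in that span.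
  have hinv : ∀ g, Relation.ReflTransGen (ColourExchange K v) f g → ∀ j,
      Submodule.span K (v '' (colourBlock g j ∩ A)) ≤
        Submodule.span K (v '' (colourBlock f j ∩ A)) := by
    intro g hg
    induction hg with
    | refl => exact fun j => le_rfl
    | @tail g g' hg hstep ih =>
      intro l
      obtain ⟨x, y, j, hx, hy, hs, rfl⟩ := hstep
      by_cases hl : l = j
      · subst hl
        rw [colourBlock_colourSwap_self, Submodule.span_le]
        rintro _ ⟨i, ⟨rfl | hi, hiA⟩, rfl⟩
        · exact ih l (hspan g hg i hx l)
        · exact ih l (Submodule.subset_span ⟨i, ⟨hi.1, hiA⟩, rfl⟩)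
      · rw [colourBlock_colourSwap_of_ne hx hy hl]
        exact ih l
  have heq : ∀ j, Submodule.span K (v '' (colourBlock f j ∩ A)) =
      Submodule.span K (v '' (A : Set ι)) := by
    intro j
    refine le_antisymm (Submodule.span_mono (Set.image_mono Set.inter_subset_right)) ?_
    rw [Submodule.span_le]
    rintro _ ⟨x, hx, rfl⟩
    obtain ⟨g, hg, hgx⟩ := hAmem.1 hx
    exact hinv g hg j (hspan g hg x hgx j)
  refine ⟨f, A, hf, ?_⟩
  have hblock : ∀ j, (A.filter fun i => f i = some j).card =
      Module.finrank K (Submodule.span K (v '' (A : Set ι))) := by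
    intro j
    have hc : ((A.filter fun i => f i = some j : Finset ι) : Set ι) = colourBlock f j ∩ A := by
      ext i; simp [colourBlock, and_comm]
    rw [← heq j, ← hc, LinearIndepOn.card_eq_finrank_span]
    rw [hc]
    exact (hf j).mono Set.inter_subset_left
  -- The empty chain of exchanges puts every index uncoloured by `f` in `A`, so all of `Aᶜ` is
  -- coloured. Within `A`, each block is a basis of the span of `A`.
  have hsplit : (Finset.univ.filter fun i => f i ≠ none) =
      (Finset.univ.biUnion fun j => A.filter fun i => f i = some j) ∪ Aᶜ := by
    ext i
    simp only [Finset.mem_filter, Finset.mem_univ, true_and, Finset.mem_union,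
      Finset.mem_biUnion, Finset.mem_compl]
    constructor
    · intro hi
      obtain ⟨j, hj⟩ := Option.ne_none_iff_exists'.1 hi
      by_cases hA : i ∈ A
      · exact Or.inl ⟨j, hA, hj⟩
      · exact Or.inr hA
    · rintro (⟨j, -, hj⟩ | hi) h
      · simp [h] at hj
      · exact hi (hAmem.2 ⟨f, .refl, h⟩)
  rw [hsplit, Finset.card_union_of_disjoint, Finset.card_biUnion]
  · simp [hblock]
  · intro j _ l _ hjl
    refine Finset.disjoint_left.2 ?_
    intro i hi hi'
    simp only [Finset.mem_filter] at hi hi'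
    exact hjl (Option.some_injective _ (hi.2.symm.trans hi'.2))
  · rw [Finset.disjoint_left]
    intro i hi
    simp only [Finset.mem_biUnion, Finset.mem_filter] at hi
    obtain ⟨j, -, hA, -⟩ := hi
    simpa using hA

end Colouring

/-! ### Edmonds' covering and packing theorems -/

/-- Edmonds' covering theorem for vectors. -/
theorem exists_partition_linearIndepOn {K : Type*} [Field K] {V : Type*} [AddCommGroup V]
    [Module K V] {ι : Type*} [Fintype ι] [DecidableEq ι] {v : ι → V} {k : ℕ}
    (h : ∀ A : Finset ι, A.card ≤ k * Module.finrank K (Submodule.span K (v '' (A : Set ι)))) :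
    ∃ f : ι → Fin k, ∀ j, LinearIndepOn K v {i | f i = j} := by
  obtain ⟨f, A, hf, hcard⟩ := exists_indepColouring_card_eq K v k
  -- For the extremal `A` the hypothesis makes the coloured count at least `A.card + Aᶜ.card`.
  have hall : (Finset.univ.filter fun i => f i ≠ none) = Finset.univ := by
    rw [← Finset.card_eq_iff_eq_univ]
    refine le_antisymm (Finset.card_le_univ _) ?_
    rw [hcard, ← Finset.card_add_card_compl A]
    exact Nat.add_le_add_right (h A) _
  have hne : ∀ i, ∃ j, f i = some j := fun i =>
    Option.ne_none_iff_exists'.1 (by simpa using Finset.ext_iff.1 hall i)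
  choose g hg using hne
  refine ⟨g, fun j => ?_⟩
  convert hf j using 1
  ext i
  simp [colourBlock, hg]

/-- Edmonds' packing theorem for vectors. -/
theorem exists_disjoint_spanning {K : Type*} [Field K] {V : Type*} [AddCommGroup V]
    [Module K V] [FiniteDimensional K V] {ι : Type*} [Fintype ι] [DecidableEq ι] {v : ι → V}
    {k : ℕ}
    (h : ∀ A : Finset ι, k * Module.finrank K V ≤
      k * Module.finrank K (Submodule.span K (v '' (A : Set ι))) + Aᶜ.card) :
    ∃ J : Fin k → Finset ι, (∀ j l, j ≠ l → Disjoint (J j) (J l)) ∧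
      ∀ j, Submodule.span K (v '' (J j : Set ι)) = ⊤ := by
  obtain ⟨f, A, hf, hcard⟩ := exists_indepColouring_card_eq K v k
  have hdisj : ∀ j l : Fin k, j ≠ l → Disjoint (Finset.univ.filter fun i => f i = some j)
      (Finset.univ.filter fun i => f i = some l) := by
    intro j l hjl
    rw [Finset.disjoint_left]
    intro i hi hi'
    simp only [Finset.mem_filter] at hi hi'
    exact hjl (Option.some_injective _ (hi.2.symm.trans hi'.2))
  refine ⟨fun j => Finset.univ.filter fun i => f i = some j, hdisj, ?_⟩
  have hrank : ∀ j, Module.finrank K (Submodule.span K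
      (v '' ((Finset.univ.filter fun i => f i = some j : Finset ι) : Set ι))) =
      (Finset.univ.filter fun i => f i = some j).card := fun j =>
    LinearIndepOn.card_eq_finrank_span (by simpa [colourBlock] using hf j)
  have hle : ∀ j ∈ Finset.univ, (Finset.univ.filter fun i => f i = some j).card ≤
      Module.finrank K V := fun j _ => hrank j ▸ Submodule.finrank_le _
  -- Each of the `k` blocks has at most `finrank K V` elements and the total is at least `k *
  -- finrank K V`, so every block is a basis.
  have hsum : ∑ j : Fin k, (Finset.univ.filter fun i => f i = some j).card =
      ∑ j : Fin k, Module.finrank K V := by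
    refine le_antisymm (Finset.sum_le_sum hle) ?_
    rw [← Finset.card_biUnion (fun j _ l _ => hdisj j l), Finset.sum_const, Finset.card_univ,
      Fintype.card_fin, smul_eq_mul]
    refine (h A).trans (hcard.symm.le.trans (Finset.card_le_card ?_))
    intro i hi
    simpa [Option.ne_none_iff_exists'] using hi
  intro j
  exact Submodule.eq_top_of_finrank_eq
    ((hrank j).trans ((Finset.sum_eq_sum_iff_of_le hle).1 hsum j (Finset.mem_univ j)))

/-- A partition into at most as many independent sets as there are vectors can be refined to one
without empty blocks. -/
theorem exists_surjective_partition_linearIndepOn {K : Type*} [Field K] {V : Type*}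
    [AddCommGroup V] [Module K V] {ι : Type*} [Fintype ι] [DecidableEq ι] {v : ι → V} {k : ℕ}
    (h0 : ∀ i, v i ≠ 0) (hk : k ≤ Fintype.card ι)
    (h : ∃ f : ι → Fin k, ∀ j, LinearIndepOn K v {i | f i = j}) :
    ∃ f : ι → Fin k, Function.Surjective f ∧ ∀ j, LinearIndepOn K v {i | f i = j} := by
  -- Take as many nonempty blocks as possible. If `m` is still empty, some block has two members `a`
  -- and `b`; moving `a` to `m` while `b` stays fills one more block.
  obtain ⟨f, hf, hmax⟩ := Set.exists_max_image
    {f : ι → Fin k | ∀ j, LinearIndepOn K v {i | f i = j}}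
    (fun f => (Finset.univ.image f).card) (Set.toFinite _) h
  refine ⟨f, ?_, hf⟩
  by_contra hsurj
  simp only [Function.Surjective, not_forall, not_exists] at hsurj
  obtain ⟨m, hm⟩ := hsurj
  have hninj : ¬ Function.Injective f := by
    intro hinj
    have hbij := (Fintype.bijective_iff_injective_and_card f).2
      ⟨hinj, le_antisymm (Fintype.card_le_of_injective f hinj) (by simpa using hk)⟩
    obtain ⟨i, hi⟩ := hbij.2 m
    exact hm i hi
  simp only [Function.Injective, not_forall] at hninj
  obtain ⟨a, b, hab, hne⟩ := hninj
  have hg : ∀ j, LinearIndepOn K v {i | Function.update f a m i = j} := by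
    intro j
    by_cases hj : j = m
    · subst hj
      have : {i | Function.update f a j i = j} = {a} := by
        ext i
        by_cases hi : i = a <;> simp [Function.update_apply, hi, hm]
      rw [this]
      exact (linearIndepOn_singleton_iff K).2 (h0 a)
    · refine (hf j).mono fun i hi => ?_
      by_cases hia : i = a
      · subst hia; simp [Ne.symm hj] at hi
      · simpa [Function.update_apply, hia] using hi
  have hsub : insert m (Finset.univ.image f) ⊆ Finset.univ.image (Function.update f a m) := by
    intro j hj
    simp only [Finset.mem_insert, Finset.mem_image, Finset.mem_univ, true_and] at hj ⊢
    rcases hj with rfl | ⟨i, rfl⟩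
    · exact ⟨a, by simp⟩
    · by_cases hi : i = a
      · subst hi; exact ⟨b, by simp [Ne.symm hne, hab]⟩
      · exact ⟨i, by simp [hi]⟩
  have h1 := Finset.card_le_card hsub
  rw [Finset.card_insert_of_notMem (by simpa using hm)] at h1
  have h2 := hmax _ hg
  omega

/-! ### The redundancy function as a quadratic form -/

namespace FiniteFrame

section Redundancy

variable {𝕜 : Type*} [RCLike 𝕜] {H : Type*} [NormedAddCommGroup H] [InnerProductSpace 𝕜 H]
  {N M : ℕ} {φ : Fin N → H}

theorem norm_smul_normalized (φ : Fin N → H) (i : Fin N) :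
    ((‖φ i‖ : ℝ) : 𝕜) • normalized 𝕜 φ i = φ i := by
  by_cases h : φ i = 0
  · simp [normalized, h]
  · have h' : ((‖φ i‖ : ℝ) : 𝕜) ≠ 0 := by simpa using h
    rw [normalized, smul_smul, RCLike.ofReal_inv, mul_inv_cancel₀ h', one_smul]

theorem norm_normalized {i : Fin N} (h : φ i ≠ 0) : ‖normalized 𝕜 φ i‖ = 1 := by
  have h' : ‖φ i‖ ≠ 0 := norm_ne_zero_iff.2 h
  rw [normalized, norm_smul, RCLike.norm_ofReal, abs_inv, abs_norm, inv_mul_cancel₀ h']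

theorem norm_normalized_le (φ : Fin N → H) (i : Fin N) : ‖normalized 𝕜 φ i‖ ≤ 1 := by
  by_cases h : φ i = 0
  · simp [normalized, h]
  · exact (norm_normalized h).le

/-- The projection onto a line is given by the inner product with a unit vector spanning it; zero
vectors contribute 0 on both sides. -/
theorem redundancy_eq_sum_inner (φ : Fin N → H) (x : H) :
    redundancy 𝕜 φ x = ∑ i, ‖inner 𝕜 x (normalized 𝕜 φ i)‖ ^ 2 := by
  refine Finset.sum_congr rfl fun i _ => ?_
  congr 1
  rw [Submodule.starProjection_singleton, normalized, inner_smul_right, norm_smul, norm_mul,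
    norm_div, RCLike.norm_ofReal, RCLike.norm_ofReal, norm_inner_symm, abs_inv, abs_norm,
    abs_pow, abs_norm]
  by_cases h : ‖φ i‖ = 0
  · simp [h]
  · field_simp

theorem continuous_redundancy (φ : Fin N → H) : Continuous (redundancy 𝕜 φ) := by
  unfold redundancy
  fun_prop

theorem redundancy_smul (φ : Fin N → H) (c : 𝕜) (x : H) :
    redundancy 𝕜 φ (c • x) = ‖c‖ ^ 2 * redundancy 𝕜 φ x := by
  simp only [redundancy, map_smul, norm_smul, mul_pow, Finset.mul_sum]

theorem redundancy_append (φ : Fin N → H) (φ' : Fin M → H) (x : H) :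
    redundancy 𝕜 (Fin.append φ φ') x = redundancy 𝕜 φ x + redundancy 𝕜 φ' x := by
  simp [redundancy, Fin.sum_univ_add]

theorem redundancy_le_card (φ : Fin N → H) (x : H) : redundancy 𝕜 φ x ≤ N * ‖x‖ ^ 2 := by
  calc redundancy 𝕜 φ x ≤ ∑ _i : Fin N, ‖x‖ ^ 2 := by
        refine Finset.sum_le_sum fun i _ => ?_
        gcongr
        exact Submodule.norm_starProjection_apply_le _ x
    _ = N * ‖x‖ ^ 2 := by simp

theorem redundancy_orthonormalBasis {n : ℕ} (e : OrthonormalBasis (Fin n) 𝕜 H) (x : H) :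
    redundancy 𝕜 e x = ‖x‖ ^ 2 := by
  rw [redundancy_eq_sum_inner, ← e.sum_sq_norm_inner_left x]
  simp [normalized]

theorem redundancy_nonneg (φ : Fin N → H) (x : H) : 0 ≤ redundancy 𝕜 φ x :=
  Finset.sum_nonneg fun _ _ => by positivity

/-- The function itself changes by the substitution `x ↦ U x`, which preserves the sphere; hence
only the set of values is invariant. -/
theorem redundancyValues_isometry (U : H ≃ₗᵢ[𝕜] H) (φ : Fin N → H) :
    redundancyValues 𝕜 (fun i => U (φ i)) = redundancyValues 𝕜 φ := by
  have h : ∀ x, redundancy 𝕜 (fun i => U (φ i)) (U x) = redundancy 𝕜 φ x := by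
    intro x
    simp [redundancy_eq_sum_inner, normalized, inner_smul_right]
  ext r
  constructor
  · rintro ⟨x, hx, rfl⟩
    refine ⟨U.symm x, by simpa using hx, ?_⟩
    rw [← h, U.apply_symm_apply]
  · rintro ⟨x, hx, rfl⟩
    exact ⟨U x, by simpa using hx, h x⟩

theorem redundancy_smul_family (φ : Fin N → H) {c : Fin N → 𝕜} (hc : ∀ i, c i ≠ 0) :
    redundancy 𝕜 (fun i => c i • φ i) = redundancy 𝕜 φ := by
  ext x
  refine Finset.sum_congr rfl fun i _ => ?_
  simp only [Submodule.starProjection_singleton, inner_smul_left, norm_smul, smul_smul]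
  congr 3
  have h1 : c i * (starRingEnd 𝕜) (c i) = ((‖c i‖ ^ 2 : ℝ) : 𝕜) := by
    rw [RCLike.mul_conj]; simp
  have h2 : ((‖c i‖ ^ 2 : ℝ) : 𝕜) ≠ 0 := by simpa using hc i
  rw [div_mul_eq_mul_div, mul_right_comm, mul_comm _ (c i), h1, mul_pow, RCLike.ofReal_mul,
    mul_div_mul_left _ _ h2]

theorem redundancy_perm (φ : Fin N → H) (π : Equiv.Perm (Fin N)) :
    redundancy 𝕜 (fun i => φ (π i)) = redundancy 𝕜 φ := by
  ext x
  exact Equiv.sum_comp π fun i => ‖(Submodule.span 𝕜 {φ i}).starProjection x‖ ^ 2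

/-- All terms vanish, so `x` is orthogonal to a spanning family. -/
theorem IsFrame.eq_zero_of_redundancy_eq_zero (hφ : IsFrame 𝕜 φ) {x : H}
    (hx : redundancy 𝕜 φ x = 0) : x = 0 := by
  rw [redundancy_eq_sum_inner, Finset.sum_eq_zero_iff_of_nonneg fun _ _ => by positivity] at hx
  have h : ∀ i, inner 𝕜 x (φ i) = 0 := by
    intro i
    have hi : inner 𝕜 x (normalized 𝕜 φ i) = 0 := by simpa using hx i (Finset.mem_univ i)
    rw [← norm_smul_normalized (𝕜 := 𝕜) φ i, inner_smul_right, hi, mul_zero]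
  have hspan : Submodule.span 𝕜 (Set.range φ) ≤ (Submodule.span 𝕜 {x})ᗮ := by
    rw [Submodule.span_le]
    rintro _ ⟨i, rfl⟩
    exact Submodule.mem_orthogonal_singleton_iff_inner_right.2 (h i)
  rw [hφ] at hspan
  exact inner_self_eq_zero.1
    (Submodule.mem_orthogonal_singleton_iff_inner_right.1 (hspan (Submodule.mem_top (x := x))))

theorem sum_redundancy_orthonormalBasis {ι : Type*} [Fintype ι] (b : OrthonormalBasis ι 𝕜 H)
    (φ : Fin N → H) : ∑ l, redundancy 𝕜 φ (b l) = ∑ i, ‖normalized 𝕜 φ i‖ ^ 2 := by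
  simp only [redundancy_eq_sum_inner]
  rw [Finset.sum_comm]
  exact Finset.sum_congr rfl fun i _ => b.sum_sq_norm_inner_right _

/-- Trace of the frame operator compressed to `W`: exchange the sums and apply Parseval in `W` to
each projected vector. -/
theorem sum_redundancy_subspace {ι : Type*} [Fintype ι] {W : Submodule 𝕜 H}
    [W.HasOrthogonalProjection] (b : OrthonormalBasis ι 𝕜 W) (φ : Fin N → H) :
    ∑ l, redundancy 𝕜 φ (b l : H) = ∑ i, ‖W.starProjection (normalized 𝕜 φ i)‖ ^ 2 := by
  simp only [redundancy_eq_sum_inner]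
  rw [Finset.sum_comm]
  refine Finset.sum_congr rfl fun i _ => ?_
  have := b.sum_sq_norm_inner_right (W.orthogonalProjectionOnto (normalized 𝕜 φ i))
  simp only [Submodule.inner_orthogonalProjectionOnto_eq_of_mem_left] at this
  rw [this, Submodule.starProjection_apply, Submodule.coe_norm]

/-- After discarding zeros, the normalized vectors form an orthonormal basis, and Parseval's
identity applies. -/
theorem redundancy_of_isOrthogonal (hφ : IsFrame 𝕜 φ) (ho : IsOrthogonal 𝕜 φ) (x : H) :
    redundancy 𝕜 φ x = ‖x‖ ^ 2 := by
  classical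
  let v : {i // φ i ≠ 0} → H := fun i => normalized 𝕜 φ i
  have hv : Orthonormal 𝕜 v := by
    refine ⟨fun i => norm_normalized i.2, fun i j hij => ?_⟩
    have := ho i j fun h => hij (Subtype.ext h)
    simp [v, normalized, inner_smul_left, inner_smul_right, this]
  have hs : ⊤ ≤ Submodule.span 𝕜 (Set.range v) := by
    rw [← hφ, Submodule.span_le]
    rintro _ ⟨i, rfl⟩
    by_cases h : φ i = 0
    · rw [h]; exact Submodule.zero_mem _
    · rw [← norm_smul_normalized (𝕜 := 𝕜) φ i]
      exact Submodule.smul_mem _ _ (Submodule.subset_span ⟨⟨i, h⟩, rfl⟩)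
  have hb := (OrthonormalBasis.mk hv hs).sum_sq_norm_inner_left x
  rw [OrthonormalBasis.coe_mk] at hb
  rw [redundancy_eq_sum_inner, ← hb]
  refine (Fintype.sum_of_injective Subtype.val Subtype.val_injective _ _ (fun i hi => ?_)
    fun _ => rfl).symm
  have h : φ i = 0 := by simpa using hi
  simp [normalized, h]

/-- Evaluated at the unit vector along `φ i`, the sum is 1, and the `i`-th term alone already equals
1. -/
theorem isOrthogonal_of_redundancy_eq (h : ∀ x, redundancy 𝕜 φ x = ‖x‖ ^ 2) :
    IsOrthogonal 𝕜 φ := by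
  intro i j hij
  by_cases hi : φ i = 0
  · simp [hi]
  have h1 := h (normalized 𝕜 φ i)
  rw [redundancy_eq_sum_inner, norm_normalized hi] at h1
  have h2 : ∑ l ∈ {i, j}, ‖inner 𝕜 (normalized 𝕜 φ i) (normalized 𝕜 φ l)‖ ^ 2 ≤ 1 ^ 2 := by
    rw [← h1]
    exact Finset.sum_le_sum_of_subset_of_nonneg (Finset.subset_univ _)
      fun _ _ _ => by positivity
  rw [Finset.sum_pair hij, inner_self_eq_norm_sq_to_K, norm_normalized hi] at h2
  have h3 : ‖inner 𝕜 (normalized 𝕜 φ i) (normalized 𝕜 φ j)‖ ^ 2 = 0 := by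
    refine le_antisymm ?_ (by positivity)
    simpa using h2
  have h4 : inner 𝕜 (normalized 𝕜 φ i) (normalized 𝕜 φ j) = 0 := by simpa using h3
  rw [← norm_smul_normalized (𝕜 := 𝕜) φ i, ← norm_smul_normalized (𝕜 := 𝕜) φ j,
    inner_smul_left, inner_smul_right, h4, mul_zero, mul_zero]

theorem redundancy_of_isEqualNorm_isParseval {c : ℝ} (hc : ∀ i, ‖φ i‖ = c)
    (hP : IsParseval 𝕜 φ) (x : H) : redundancy 𝕜 φ x = c⁻¹ ^ 2 * ‖x‖ ^ 2 := by
  have h := hP.2 x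
  rw [one_mul] at h
  rw [redundancy_eq_sum_inner, ← h, Finset.mul_sum]
  refine Finset.sum_congr rfl fun i _ => ?_
  rw [normalized, inner_smul_right, norm_mul, mul_pow, RCLike.norm_ofReal, hc, sq_abs]

theorem redundancyValues_nonempty [Nontrivial H] (φ : Fin N → H) : (redundancyValues 𝕜 φ).Nonempty := by
  have : NormedSpace ℝ H := .restrictScalars ℝ 𝕜 H
  exact (NormedSpace.sphere_nonempty.2 zero_le_one).image _

/-! ### Extreme values on the sphere and counting in subspaces -/

section Extrema

variable [FiniteDimensional 𝕜 H]

theorem isCompact_redundancyValues (φ : Fin N → H) : IsCompact (redundancyValues 𝕜 φ) := by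
  have := FiniteDimensional.proper_rclike 𝕜 H
  exact (isCompact_sphere 0 1).image (continuous_redundancy φ)

theorem lowerRedundancy_mul_le (φ : Fin N → H) (x : H) :
    lowerRedundancy 𝕜 φ * ‖x‖ ^ 2 ≤ redundancy 𝕜 φ x := by
  by_cases hx : x = 0
  · simpa [hx] using redundancy_nonneg φ (0 : H)
  have hx' : ‖x‖ ≠ 0 := norm_ne_zero_iff.2 hx
  have h : lowerRedundancy 𝕜 φ ≤ redundancy 𝕜 φ (((‖x‖⁻¹ : ℝ) : 𝕜) • x) :=
    csInf_le (isCompact_redundancyValues φ).bddBelow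
      ⟨_, by simp [norm_smul, hx'], rfl⟩
  rw [redundancy_smul, RCLike.norm_ofReal, sq_abs, inv_pow, ← div_eq_inv_mul,
    le_div_iff₀ (by positivity)] at h
  exact h

theorem redundancy_le_upperRedundancy_mul (φ : Fin N → H) (x : H) :
    redundancy 𝕜 φ x ≤ upperRedundancy 𝕜 φ * ‖x‖ ^ 2 := by
  by_cases hx : x = 0
  · simp [hx, redundancy]
  have hx' : ‖x‖ ≠ 0 := norm_ne_zero_iff.2 hx
  have h : redundancy 𝕜 φ (((‖x‖⁻¹ : ℝ) : 𝕜) • x) ≤ upperRedundancy 𝕜 φ :=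
    le_csSup (isCompact_redundancyValues φ).bddAbove
      ⟨_, by simp [norm_smul, hx'], rfl⟩
  rw [redundancy_smul, RCLike.norm_ofReal, sq_abs, inv_pow, ← div_eq_inv_mul,
    div_le_iff₀ (by positivity)] at h
  exact h

/-- Bound the trace over `W`: above by the maximum on each basis vector, below by 1 for each index
of `A`. -/
theorem card_mem_le (h0 : ∀ i, φ i ≠ 0) (W : Submodule 𝕜 H) {A : Finset (Fin N)}
    (hA : ∀ i ∈ A, φ i ∈ W) : (A.card : ℝ) ≤ upperRedundancy 𝕜 φ * Module.finrank 𝕜 W := by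
  have hsum := sum_redundancy_subspace (stdOrthonormalBasis 𝕜 W) φ
  have h1 : ∑ l, redundancy 𝕜 φ (stdOrthonormalBasis 𝕜 W l : H) ≤
      ∑ _l : Fin (Module.finrank 𝕜 W), upperRedundancy 𝕜 φ := by
    refine Finset.sum_le_sum fun l _ => (redundancy_le_upperRedundancy_mul φ _).trans ?_
    have : ‖(stdOrthonormalBasis 𝕜 W l : H)‖ = 1 := (stdOrthonormalBasis 𝕜 W).norm_eq_one l
    simp [this]
  have h2 : ∑ i ∈ A, (1 : ℝ) ≤ ∑ i, ‖W.starProjection (normalized 𝕜 φ i)‖ ^ 2 := by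
    refine le_trans (Finset.sum_le_sum fun i hi => ?_)
      (Finset.sum_le_sum_of_subset_of_nonneg (Finset.subset_univ A) fun _ _ _ => by positivity)
    have hm : normalized 𝕜 φ i ∈ W := W.smul_mem _ (hA i hi)
    rw [Submodule.norm_starProjection_apply _ hm, norm_normalized (h0 i), one_pow]
  rw [← hsum] at h2
  simpa [mul_comm] using h2.trans h1

/-- Bound the trace over `Wᗮ`: indices outside `B` contribute 0, and those in `B` at most 1. -/
theorem le_card_of_forall_notMem (W : Submodule 𝕜 H) {B : Finset (Fin N)}
    (hB : ∀ i ∉ B, φ i ∈ W) : lowerRedundancy 𝕜 φ * Module.finrank 𝕜 Wᗮ ≤ B.card := by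
  have hsum := sum_redundancy_subspace (stdOrthonormalBasis 𝕜 Wᗮ) φ
  have h1 : ∑ _l : Fin (Module.finrank 𝕜 Wᗮ), lowerRedundancy 𝕜 φ ≤
      ∑ l, redundancy 𝕜 φ (stdOrthonormalBasis 𝕜 Wᗮ l : H) := by
    refine Finset.sum_le_sum fun l _ => le_trans ?_ (lowerRedundancy_mul_le φ _)
    have : ‖(stdOrthonormalBasis 𝕜 Wᗮ l : H)‖ = 1 := (stdOrthonormalBasis 𝕜 Wᗮ).norm_eq_one l
    simp [this]
  have h2 : ∑ i, ‖Wᗮ.starProjection (normalized 𝕜 φ i)‖ ^ 2 ≤ ∑ i ∈ B, (1 : ℝ) := by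
    rw [← Finset.sum_subset (Finset.subset_univ B) fun i _ hi => ?_]
    · refine Finset.sum_le_sum fun i _ => pow_le_one₀ (norm_nonneg _) ?_
      exact (Submodule.norm_starProjection_apply_le _ _).trans (norm_normalized_le φ i)
    · have hm : normalized 𝕜 φ i ∈ Wᗮᗮ :=
        W.le_orthogonal_orthogonal (W.smul_mem _ (hB i hi))
      rw [(Submodule.starProjection_apply_eq_zero_iff _).2 hm]
      simp
  rw [← hsum] at h2
  simpa [mul_comm] using h1.trans h2

theorem exists_disjoint_spanning_floor_lowerRedundancy (φ : Fin N → H) :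
    ∃ J : Fin ⌊lowerRedundancy 𝕜 φ⌋₊ → Finset (Fin N),
      (∀ k l, k ≠ l → Disjoint (J k) (J l)) ∧
      ∀ k, Submodule.span 𝕜 (φ '' (J k : Set (Fin N))) = ⊤ := by
  -- A positive floor supplies the nonnegativity that `Nat.floor_le` needs.
  rcases Nat.eq_zero_or_pos ⌊lowerRedundancy 𝕜 φ⌋₊ with hz | hpos
  · exact ⟨fun _ => ∅, fun k => absurd k.2 (by omega), fun k => absurd k.2 (by omega)⟩
  have hfl : (⌊lowerRedundancy 𝕜 φ⌋₊ : ℝ) ≤ lowerRedundancy 𝕜 φ :=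
    Nat.floor_le (Nat.pos_of_floor_pos hpos).le
  refine exists_disjoint_spanning fun A => ?_
  -- With `W` the span of `A`, splitting `H` into `W` and `Wᗮ` reduces Edmonds' condition to `k *
  -- dim Wᗮ ≤ Aᶜ.card`.
  rw [← (Submodule.span 𝕜 (φ '' (A : Set (Fin N)))).finrank_add_finrank_orthogonal, mul_add]
  refine Nat.add_le_add_left ?_ _
  have h := le_card_of_forall_notMem (Submodule.span 𝕜 (φ '' (A : Set (Fin N)))) (B := Aᶜ)
    fun i hi => Submodule.subset_span ⟨i, by simpa using hi, rfl⟩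
  exact_mod_cast (mul_le_mul_of_nonneg_right hfl (Nat.cast_nonneg _)).trans h

variable [Nontrivial H]

theorem isLeast_lowerRedundancy (φ : Fin N → H) :
    IsLeast (redundancyValues 𝕜 φ) (lowerRedundancy 𝕜 φ) :=
  (isCompact_redundancyValues φ).isLeast_sInf (redundancyValues_nonempty φ)

theorem isGreatest_upperRedundancy (φ : Fin N → H) :
    IsGreatest (redundancyValues 𝕜 φ) (upperRedundancy 𝕜 φ) :=
  (isCompact_redundancyValues φ).isGreatest_sSup (redundancyValues_nonempty φ)

theorem lowerRedundancy_le_upperRedundancy (φ : Fin N → H) :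
    lowerRedundancy 𝕜 φ ≤ upperRedundancy 𝕜 φ :=
  (isLeast_lowerRedundancy φ).2 (isGreatest_upperRedundancy φ).1

theorem IsFrame.lowerRedundancy_pos (hφ : IsFrame 𝕜 φ) : 0 < lowerRedundancy 𝕜 φ := by
  obtain ⟨x, hx, hxr⟩ := (isLeast_lowerRedundancy (𝕜 := 𝕜) φ).1
  rw [← hxr]
  refine (redundancy_nonneg φ x).lt_of_ne' fun h => ?_
  simp [hφ.eq_zero_of_redundancy_eq_zero h] at hx

theorem upperRedundancy_le_card (φ : Fin N → H) : upperRedundancy 𝕜 φ ≤ N := by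
  obtain ⟨x, hx, hxr⟩ := (isGreatest_upperRedundancy (𝕜 := 𝕜) φ).1
  rw [← hxr]
  simpa [mem_sphere_zero_iff_norm.1 hx] using redundancy_le_card (𝕜 := 𝕜) φ x

theorem lowerRedundancy_eq_upperRedundancy_eq_iff {A : ℝ} :
    lowerRedundancy 𝕜 φ = A ∧ upperRedundancy 𝕜 φ = A ↔
      ∀ x, redundancy 𝕜 φ x = A * ‖x‖ ^ 2 := by
  constructor
  · rintro ⟨h1, h2⟩ x
    have := lowerRedundancy_mul_le (𝕜 := 𝕜) φ x
    have := redundancy_le_upperRedundancy_mul (𝕜 := 𝕜) φ x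
    rw [h1] at *
    rw [h2] at *
    linarith
  · intro h
    obtain ⟨x, hx, hxr⟩ := (isLeast_lowerRedundancy (𝕜 := 𝕜) φ).1
    obtain ⟨y, hy, hyr⟩ := (isGreatest_upperRedundancy (𝕜 := 𝕜) φ).1
    rw [← hxr, ← hyr, h, h, mem_sphere_zero_iff_norm.1 hx, mem_sphere_zero_iff_norm.1 hy]
    simp

theorem IsFrame.lowerRedundancy_eq_upperRedundancy_iff (hφ : IsFrame 𝕜 φ) :
    lowerRedundancy 𝕜 φ = upperRedundancy 𝕜 φ ↔ IsTight 𝕜 (normalized 𝕜 φ) := by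
  constructor
  · intro h
    refine ⟨_, hφ.lowerRedundancy_pos, fun x => ?_⟩
    rw [← redundancy_eq_sum_inner]
    exact lowerRedundancy_eq_upperRedundancy_eq_iff.1 ⟨rfl, h.symm⟩ x
  · rintro ⟨A, -, h⟩
    obtain ⟨h1, h2⟩ := (lowerRedundancy_eq_upperRedundancy_eq_iff (φ := φ) (A := A)).2
      fun x => (redundancy_eq_sum_inner φ x).trans (h x)
    exact h1.trans h2.symm

theorem redundancy_eq_card_div_finrank (hE : IsEqualNorm φ) (hP : IsParseval 𝕜 φ) :
    lowerRedundancy 𝕜 φ = (N : ℝ) / Module.finrank 𝕜 H ∧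
      upperRedundancy 𝕜 φ = (N : ℝ) / Module.finrank 𝕜 H := by
  obtain ⟨c, hc0, hc⟩ := hE
  have hr := redundancy_of_isEqualNorm_isParseval hc hP
  have htr := sum_redundancy_orthonormalBasis (stdOrthonormalBasis 𝕜 H) φ
  have hne : ∀ i, φ i ≠ 0 := fun i => norm_ne_zero_iff.1 (hc i ▸ hc0.ne')
  -- The trace, computed in two ways, is `finrank 𝕜 H * c⁻¹ ^ 2` and `N`.
  have hA : c⁻¹ ^ 2 = (N : ℝ) / Module.finrank 𝕜 H := by
    have hd : (Module.finrank 𝕜 H : ℝ) ≠ 0 := by exact_mod_cast Module.finrank_pos.ne'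
    rw [eq_div_iff hd, mul_comm]
    simpa [hr, norm_normalized (hne _)] using htr
  rw [← hA]
  exact lowerRedundancy_eq_upperRedundancy_eq_iff.2 hr

theorem IsFrame.redundancy_eq_one_iff (hφ : IsFrame 𝕜 φ) :
    lowerRedundancy 𝕜 φ = 1 ∧ upperRedundancy 𝕜 φ = 1 ↔ IsOrthogonal 𝕜 φ := by
  rw [lowerRedundancy_eq_upperRedundancy_eq_iff]
  simp only [one_mul]
  exact ⟨isOrthogonal_of_redundancy_eq, redundancy_of_isOrthogonal hφ⟩

theorem redundancy_append_orthonormalBasis {n : ℕ} (φ : Fin N → H)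
    (e : OrthonormalBasis (Fin n) 𝕜 H) :
    lowerRedundancy 𝕜 (Fin.append φ e) = lowerRedundancy 𝕜 φ + 1 ∧
      upperRedundancy 𝕜 (Fin.append φ e) = upperRedundancy 𝕜 φ + 1 := by
  have h : ∀ x ∈ Metric.sphere (0 : H) 1,
      redundancy 𝕜 (Fin.append φ e) x = redundancy 𝕜 φ x + 1 := by
    intro x hx
    rw [redundancy_append, redundancy_orthonormalBasis, mem_sphere_zero_iff_norm.1 hx, one_pow]
  obtain ⟨⟨x, hx, hxr⟩, hl⟩ := isLeast_lowerRedundancy (𝕜 := 𝕜) φ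
  obtain ⟨⟨y, hy, hyr⟩, hu⟩ := isGreatest_upperRedundancy (𝕜 := 𝕜) φ
  constructor
  · refine IsLeast.csInf_eq ⟨⟨x, hx, by rw [h x hx, hxr]⟩, ?_⟩
    rintro _ ⟨z, hz, rfl⟩
    rw [h z hz]
    exact add_le_add_left (hl ⟨z, hz, rfl⟩) 1
  · refine IsGreatest.csSup_eq ⟨⟨y, hy, by rw [h y hy, hyr]⟩, ?_⟩
    rintro _ ⟨z, hz, rfl⟩
    rw [h z hz]
    exact add_le_add_left (hu ⟨z, hz, rfl⟩) 1

theorem lowerRedundancy_add_le_append (φ : Fin N → H) (φ' : Fin M → H) :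
    lowerRedundancy 𝕜 φ + lowerRedundancy 𝕜 φ' ≤ lowerRedundancy 𝕜 (Fin.append φ φ') := by
  obtain ⟨x, hx, hxr⟩ := (isLeast_lowerRedundancy (𝕜 := 𝕜) (Fin.append φ φ')).1
  rw [← hxr, redundancy_append]
  exact add_le_add ((isLeast_lowerRedundancy φ).2 ⟨x, hx, rfl⟩)
    ((isLeast_lowerRedundancy φ').2 ⟨x, hx, rfl⟩)

theorem upperRedundancy_append_le_add (φ : Fin N → H) (φ' : Fin M → H) :
    upperRedundancy 𝕜 (Fin.append φ φ') ≤ upperRedundancy 𝕜 φ + upperRedundancy 𝕜 φ' := by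
  obtain ⟨x, hx, hxr⟩ := (isGreatest_upperRedundancy (𝕜 := 𝕜) (Fin.append φ φ')).1
  rw [← hxr, redundancy_append]
  exact add_le_add ((isGreatest_upperRedundancy φ).2 ⟨x, hx, rfl⟩)
    ((isGreatest_upperRedundancy φ').2 ⟨x, hx, rfl⟩)

theorem exists_partition_ceil_upperRedundancy (h0 : ∀ i, φ i ≠ 0) :
    ∃ f : Fin N → Fin ⌈upperRedundancy 𝕜 φ⌉₊, Function.Surjective f ∧
      ∀ k, LinearIndepOn 𝕜 φ {i | f i = k} := by
  refine exists_surjective_partition_linearIndepOn h0 ?_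
    (exists_partition_linearIndepOn fun A => ?_)
  · rw [Fintype.card_fin]
    exact Nat.ceil_le.2 (upperRedundancy_le_card φ)
  · have h := card_mem_le h0 (Submodule.span 𝕜 (φ '' (A : Set (Fin N)))) (A := A)
      fun i hi => Submodule.subset_span ⟨i, hi, rfl⟩
    exact_mod_cast h.trans (mul_le_mul_of_nonneg_right (Nat.le_ceil _) (Nat.cast_nonneg _))

end Extrema

end Redundancy

/-- A deletion meeting fewer blocks than there are disjoint spanning sets preserves spanning. -/
theorem span_compl_eq_top_of_disjoint_spanning {K V ι : Type*} [Field K] [AddCommGroup V]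
    [Module K V] {v : ι → V} {k : ℕ} {J : Fin k → Finset ι}
    (hd : ∀ j l, j ≠ l → Disjoint (J j) (J l))
    (hs : ∀ j, Submodule.span K (v '' (J j : Set ι)) = ⊤) {E : Finset ι} (hE : E.card < k) :
    Submodule.span K (v '' {i | i ∉ E}) = ⊤ := by
  -- If `E` met every block, choosing a common element for each would inject `Fin k` into `E`.
  have hj : ∃ j, Disjoint (J j) E := by
    by_contra! h
    simp only [Finset.not_disjoint_iff] at h
    choose g hgJ hgE using h
    have hinj : Function.Injective g := by
      intro j l hjl
      by_contra hne
      exact Finset.disjoint_left.1 (hd j l hne) (hgJ j) (hjl ▸ hgJ l)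
    have := Finset.card_le_card_of_injOn (s := Finset.univ) g (fun j _ => hgE j) hinj.injOn
    simp at this
    omega
  obtain ⟨j, hj⟩ := hj
  refine eq_top_iff.2 ((hs j).symm.le.trans (Submodule.span_mono (Set.image_mono ?_)))
  exact fun i hi => Finset.disjoint_left.1 hj hi

end FiniteFrame

theorem theorem2p4 {𝕜 : Type*} [RCLike 𝕜] {H : Type*} [NormedAddCommGroup H]
    [InnerProductSpace 𝕜 H] [FiniteDimensional 𝕜 H] (n N : ℕ)
    (hn : Module.finrank 𝕜 H = n) (hn0 : 0 < n)
    (φ : Fin N → H) (hφ : FiniteFrame.IsFrame 𝕜 φ) :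
    -- [D1] generalization
    (FiniteFrame.IsEqualNorm φ → FiniteFrame.IsParseval 𝕜 φ →
      FiniteFrame.lowerRedundancy 𝕜 φ = (N : ℝ) / n ∧
      FiniteFrame.upperRedundancy 𝕜 φ = (N : ℝ) / n) ∧
    -- [D2] Nyquist property
    ((FiniteFrame.lowerRedundancy 𝕜 φ = FiniteFrame.upperRedundancy 𝕜 φ ↔
        FiniteFrame.IsTight 𝕜 (FiniteFrame.normalized 𝕜 φ)) ∧
      (FiniteFrame.lowerRedundancy 𝕜 φ = 1 ∧ FiniteFrame.upperRedundancy 𝕜 φ = 1 ↔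
        FiniteFrame.IsOrthogonal 𝕜 φ)) ∧
    -- [D3] the two redundancies are an attained minimum and an attained (finite) maximum
    (IsLeast (FiniteFrame.redundancyValues 𝕜 φ) (FiniteFrame.lowerRedundancy 𝕜 φ) ∧
      IsGreatest (FiniteFrame.redundancyValues 𝕜 φ) (FiniteFrame.upperRedundancy 𝕜 φ) ∧
      0 < FiniteFrame.lowerRedundancy 𝕜 φ ∧
      FiniteFrame.lowerRedundancy 𝕜 φ ≤ FiniteFrame.upperRedundancy 𝕜 φ) ∧
    -- [D4] additivity
    ((∀ e : OrthonormalBasis (Fin n) 𝕜 H,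
        FiniteFrame.lowerRedundancy 𝕜 (Fin.append φ e) =
          FiniteFrame.lowerRedundancy 𝕜 φ + 1 ∧
        FiniteFrame.upperRedundancy 𝕜 (Fin.append φ e) =
          FiniteFrame.upperRedundancy 𝕜 φ + 1) ∧
      ∀ (M : ℕ) (φ' : Fin M → H), FiniteFrame.IsFrame 𝕜 φ' →
        FiniteFrame.lowerRedundancy 𝕜 φ + FiniteFrame.lowerRedundancy 𝕜 φ' ≤
          FiniteFrame.lowerRedundancy 𝕜 (Fin.append φ φ') ∧
        FiniteFrame.upperRedundancy 𝕜 (Fin.append φ φ') ≤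
          FiniteFrame.upperRedundancy 𝕜 φ + FiniteFrame.upperRedundancy 𝕜 φ' ∧
        (∀ r r' : ℝ,
          FiniteFrame.lowerRedundancy 𝕜 φ = r → FiniteFrame.upperRedundancy 𝕜 φ = r →
          FiniteFrame.lowerRedundancy 𝕜 φ' = r' → FiniteFrame.upperRedundancy 𝕜 φ' = r' →
          FiniteFrame.lowerRedundancy 𝕜 (Fin.append φ φ') = r + r' ∧
          FiniteFrame.upperRedundancy 𝕜 (Fin.append φ φ') = r + r')) ∧
    -- [D5] invariance
    ((∀ U : H ≃ₗᵢ[𝕜] H,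
        FiniteFrame.lowerRedundancy 𝕜 (fun i => U (φ i)) = FiniteFrame.lowerRedundancy 𝕜 φ ∧
        FiniteFrame.upperRedundancy 𝕜 (fun i => U (φ i)) = FiniteFrame.upperRedundancy 𝕜 φ) ∧
      (∀ c : Fin N → 𝕜, (∀ i, c i ≠ 0) →
        FiniteFrame.lowerRedundancy 𝕜 (fun i => c i • φ i) = FiniteFrame.lowerRedundancy 𝕜 φ ∧
        FiniteFrame.upperRedundancy 𝕜 (fun i => c i • φ i) = FiniteFrame.upperRedundancy 𝕜 φ) ∧
      (∀ π : Equiv.Perm (Fin N),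
        FiniteFrame.lowerRedundancy 𝕜 (fun i => φ (π i)) = FiniteFrame.lowerRedundancy 𝕜 φ ∧
        FiniteFrame.upperRedundancy 𝕜 (fun i => φ (π i)) = FiniteFrame.upperRedundancy 𝕜 φ)) ∧
    -- [D6] spanning sets
    ((∃ J : Fin ⌊FiniteFrame.lowerRedundancy 𝕜 φ⌋₊ → Finset (Fin N),
        (∀ k l, k ≠ l → Disjoint (J k) (J l)) ∧
        ∀ k, Submodule.span 𝕜 (φ '' (J k : Set (Fin N))) = ⊤) ∧
      (∀ E : Finset (Fin N), E.card + 1 ≤ ⌊FiniteFrame.lowerRedundancy 𝕜 φ⌋₊ →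
        Submodule.span 𝕜 (φ '' {i | i ∉ E}) = ⊤)) ∧
    -- [D7] partition (with nonempty blocks) into linearly independent sets
    ((∀ i, φ i ≠ 0) →
      ∃ f : Fin N → Fin ⌈FiniteFrame.upperRedundancy 𝕜 φ⌉₊, Function.Surjective f ∧
        ∀ k, LinearIndependent 𝕜 (fun i : {i : Fin N // f i = k} => φ i)) := by
  open FiniteFrame in
  subst hn
  -- Makes the unit sphere nonempty, so the extrema are attained.
  have : Nontrivial H := Module.nontrivial_of_finrank_pos (R := 𝕜) hn0
  refine ⟨redundancy_eq_card_div_finrank,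
    ⟨hφ.lowerRedundancy_eq_upperRedundancy_iff, hφ.redundancy_eq_one_iff⟩,
    ⟨isLeast_lowerRedundancy φ, isGreatest_upperRedundancy φ, hφ.lowerRedundancy_pos,
      lowerRedundancy_le_upperRedundancy φ⟩,
    ⟨redundancy_append_orthonormalBasis φ, fun M φ' _ =>
      ⟨lowerRedundancy_add_le_append φ φ', upperRedundancy_append_le_add φ φ', ?_⟩⟩,
    ⟨fun U => ?_, fun c hc => ?_, fun π => ?_⟩,
    ⟨exists_disjoint_spanning_floor_lowerRedundancy φ, fun E hE => ?_⟩,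
    fun h0 => exists_partition_ceil_upperRedundancy h0⟩
  · intro r r' h1 h2 h3 h4
    have hl := lowerRedundancy_add_le_append (𝕜 := 𝕜) φ φ'
    have hu := upperRedundancy_append_le_add (𝕜 := 𝕜) φ φ'
    have hlu := lowerRedundancy_le_upperRedundancy (𝕜 := 𝕜) (Fin.append φ φ')
    constructor <;> linarith
  · simp only [lowerRedundancy, upperRedundancy, redundancyValues_isometry, and_self]
  · simp only [lowerRedundancy, upperRedundancy, redundancyValues, redundancy_smul_family φ hc,
      and_self]
  · simp only [lowerRedundancy, upperRedundancy, redundancyValues, redundancy_perm, and_self]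
  · obtain ⟨J, hJ, hJs⟩ := exists_disjoint_spanning_floor_lowerRedundancy (𝕜 := 𝕜) φ
    exact span_compl_eq_top_of_disjoint_spanning hJ hJs hE
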